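/- **Lemma 5.1 (Cone-Splitting Lemma).** Let $(N^m,g)$ be a smooth Riemannian manifold (second countable, without boundary) with Riemannian distance $\mathrm{dist}$, let $n\ge 0$, and let $\Lambda\in\mathbb R$, $\epsilon,\tau,\gamma>0$. There exists $\delta=\delta(n,N^m,\Lambda,\epsilon,\tau,\gamma)>0$ with the following property. Let $f:B_{\gamma^{-1}}(0^n)\subseteq\mathbb R^n\to N^m$ be a stationary harmonic map with $\int_{B_{\gamma^{-1}}(0^n)}|\nabla f|^2<\Lambda$. Let $k\ge 0$ and assume: 1. $f$ is $(\delta,\gamma^{-1},k)$-homogeneous at $0^n$, with defining $k$-plane $V^k$; 2. there is $y\in B_1(0^n)\setminus T_\tau(V^k_{f,0^n})$, where $V^k_{f,0^n}=V^k\cap B_{\gamma^{-1}}(0^n)$ and $T_\tau(A)=\{z:\mathrm{dist}(z,A)<\tau\}$, such that $f$ is $(\delta,2,0)$-homogeneous at $y$. Then $f$ is $(\epsilon,1,k+1)$-homogeneous at $0^n$. *Definitions.* A measurable map $h:\mathbb R^n\to N$ is $k$-homogeneous with respect to a $k$-dimensional linear subspace $V^k\subseteq\mathbb R^n$ if $h(\lambda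 z)=h(z)$ for all $\lambda>0$, $z\in\mathbb R^n$, and $h(z+v)=h(z)$ for all $z\in\mathbb R^n$, $v\in V^k$. A map $f$ defined on an open set $U\subseteq\mathbb R^n$ is $(\epsilon,r,k)$-homogeneous at $x$, with defining $k$-plane $V^k$, if $B_r(x)\subseteq U$ and there is a map $h$, $k$-homogeneous with respect to $V^k$, with $$\frac{1}{|B_1(0^n)|}\int_{B_1(0^n)}\mathrm{dist}\big(f(x+rz),h(z)\big)^2\,dz<\epsilon .$$ Let $\Phi:N\to\mathbb R^L$ be a smooth isometric embedding ($\delta$ does not depend on it) and $u=\Phi\circ f$; the energy is $\int|\nabla f|^2=\int\sum_i|\partial_iu|^2$. The (measurable) map $f:U\to N$ is stationary harmonic if $u\in W^{1,2}(U;\mathbb R^L)$, if $\int_U\sum_i\langle\partial_iu,\partial_iX\rangle=0$ for every bounded, compactly supported $X\in W^{1,2}(U;\mathbb R^L)$ with $X(x)\in d\Phi(T_{f(x)}N)$ for a.e. $x$ (weak harmonicity), and if $\int_U\big(|\nabla u|^2\,\mathrm{div}\,\xi-2\sum_{i,j}\langle\partial_iu,\partial_ju\rangle\,\partial_i\xi_j\big)=0$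 for every $\xi\in C_c^\infty(U;\mathbb R^n)$ (stationarity under domain variations). -/

import Mathlib

open MeasureTheory Set Bundle
open scoped ENNReal ContDiff Manifold

noncomputable section

/-- `Φ` is a smooth isometric embedding of the Riemannian manifold `N` into a Euclidean space:
a topological embedding which is smooth and whose differential preserves the length of tangent
vectors. -/
structure IsIsometricEmbedding {m L : ℕ} {N : Type*} [TopologicalSpace N]
    [ChartedSpace (EuclideanSpace ℝ (Fin m)) N]
    [RiemannianBundle (fun p : N => TangentSpace (𝓡 m) p)]
    (Φ : N → EuclideanSpace ℝ (Fin L)) : Prop where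
  isEmbedding : Topology.IsEmbedding Φ
  contMDiff : ContMDiff (𝓡 m) 𝓘(ℝ, EuclideanSpace ℝ (Fin L)) ∞ Φ
  norm_mfderiv : ∀ (p : N) (v : TangentSpace (𝓡 m) p),
    ‖mfderiv (𝓡 m) 𝓘(ℝ, EuclideanSpace ℝ (Fin L)) Φ p v‖ = ‖v‖

/-- The `i`-th partial derivative of a (differentiable) function on `ℝⁿ`. -/
def partialDeriv {n : ℕ} (i : Fin n) (φ : EuclideanSpace ℝ (Fin n) → ℝ)
    (x : EuclideanSpace ℝ (Fin n)) : ℝ :=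
  fderiv ℝ φ x (EuclideanSpace.single i 1)

/-- `Du 0, …, Du (n-1)` are the weak (distributional) partial derivatives on the open set `U` of
the vector valued function `u`. Only the values on `U` matter. -/
structure HasWeakGradOn {n L : ℕ} (U : Set (EuclideanSpace ℝ (Fin n)))
    (u : EuclideanSpace ℝ (Fin n) → EuclideanSpace ℝ (Fin L))
    (Du : Fin n → EuclideanSpace ℝ (Fin n) → EuclideanSpace ℝ (Fin L)) : Prop where
  locallyIntegrableOn : LocallyIntegrableOn u U
  locallyIntegrableOn_grad : ∀ i, LocallyIntegrableOn (Du i) U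
  integral_eq : ∀ φ : EuclideanSpace ℝ (Fin n) → ℝ,
    ContDiff ℝ ∞ φ → HasCompactSupport φ → tsupport φ ⊆ U →
    ∀ i, ∫ x in U, partialDeriv i φ x • u x = - ∫ x in U, φ x • Du i x

/-- `u ∈ W^{1,2}(U; ℝᴸ)`, with weak partial derivatives `Du`. -/
structure MemW12On {n L : ℕ} (U : Set (EuclideanSpace ℝ (Fin n)))
    (u : EuclideanSpace ℝ (Fin n) → EuclideanSpace ℝ (Fin L))
    (Du : Fin n → EuclideanSpace ℝ (Fin n) → EuclideanSpace ℝ (Fin L)) : Prop where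
  hasWeakGradOn : HasWeakGradOn U u Du
  memLp : MemLp u 2 (volume.restrict U)
  memLp_grad : ∀ i, MemLp (Du i) 2 (volume.restrict U)

/-- The Dirichlet energy `∫_U |∇u|²`, where `|∇u|² = ∑ᵢ |∂ᵢu|²` (it is `∞` if `u` has no weak
gradient; the infimum is over the weak gradients of `u`, which agree almost everywhere on `U`). -/
def dirichletEnergy {n L : ℕ} (U : Set (EuclideanSpace ℝ (Fin n)))
    (u : EuclideanSpace ℝ (Fin n) → EuclideanSpace ℝ (Fin L)) : ℝ≥0∞ :=
  ⨅ (Du : Fin n → EuclideanSpace ℝ (Fin n) → EuclideanSpace ℝ (Fin L))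
    (_ : HasWeakGradOn U u Du), ∫⁻ x in U, ∑ i, ‖Du i x‖ₑ ^ 2

/-- `X` is a vector field along the map `f` (seen in `ℝᴸ` through `Φ`): `X x` is tangent to the
submanifold `Φ(N)` at `Φ (f x)` for almost every `x ∈ U`. -/
def IsTangentAlong {n m L : ℕ} {N : Type*} [TopologicalSpace N]
    [ChartedSpace (EuclideanSpace ℝ (Fin m)) N]
    (Φ : N → EuclideanSpace ℝ (Fin L)) (U : Set (EuclideanSpace ℝ (Fin n)))
    (f : EuclideanSpace ℝ (Fin n) → N)
    (X : EuclideanSpace ℝ (Fin n) → EuclideanSpace ℝ (Fin L)) : Prop :=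
  ∀ᵐ x ∂(volume.restrict U), ∃ v : TangentSpace (𝓡 m) (f x),
    mfderiv (𝓡 m) 𝓘(ℝ, EuclideanSpace ℝ (Fin L)) Φ (f x) v = X x

/-- The map `f : U → N` is a stationary harmonic map on the open set `U ⊆ ℝⁿ`. With
`u = Φ ∘ f`:
* `u ∈ W^{1,2}(U; ℝᴸ)`;
* `f` is weakly harmonic: the first variation `∑ᵢ ∫ ⟨∂ᵢu, ∂ᵢX⟩` of the Dirichlet energy
  vanishes for all bounded compactly supported `W^{1,2}` vector fields `X` tangent to the target
  along `f` (the weak form of `Δu ⟂ T_u N`);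
* `f` is stationary: the first variation of the Dirichlet energy under domain variations
  `x ↦ x + t ξ(x)` vanishes for all smooth vector fields `ξ` with compact support in `U`, i.e.
  `∫ (|∇u|² div ξ - 2 ∑ᵢⱼ ⟨∂ᵢu, ∂ⱼu⟩ ∂ᵢξⱼ) = 0`. -/
structure IsStationaryHarmonicMap {n m L : ℕ} {N : Type*} [TopologicalSpace N]
    [ChartedSpace (EuclideanSpace ℝ (Fin m)) N] [MeasurableSpace N]
    (Φ : N → EuclideanSpace ℝ (Fin L)) (U : Set (EuclideanSpace ℝ (Fin n)))
    (f : EuclideanSpace ℝ (Fin n) → N) : Prop where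
  aemeasurable : AEMeasurable f (volume.restrict U)
  exists_grad : ∃ Du : Fin n → EuclideanSpace ℝ (Fin n) → EuclideanSpace ℝ (Fin L),
    MemW12On U (Φ ∘ f) Du ∧
    (∀ (X : EuclideanSpace ℝ (Fin n) → EuclideanSpace ℝ (Fin L))
        (DX : Fin n → EuclideanSpace ℝ (Fin n) → EuclideanSpace ℝ (Fin L)),
      MemW12On U X DX → (∃ C : ℝ, ∀ x, ‖X x‖ ≤ C) → HasCompactSupport X → tsupport X ⊆ U →
      IsTangentAlong (m := m) Φ U f X →
      ∫ x in U, ∑ i, inner ℝ (Du i x) (DX i x) = 0) ∧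
    (∀ ξ : Fin n → EuclideanSpace ℝ (Fin n) → ℝ,
      (∀ j, ContDiff ℝ ∞ (ξ j) ∧ HasCompactSupport (ξ j) ∧ tsupport (ξ j) ⊆ U) →
      ∫ x in U, ((∑ i, ‖Du i x‖ ^ 2) * (∑ j, partialDeriv j (ξ j) x)
        - 2 * ∑ i, ∑ j, inner ℝ (Du i x) (Du j x) * partialDeriv i (ξ j) x) = 0)

/-- The measurable map `h : ℝⁿ → N` is `k`-homogeneous at `y` with respect to the `k`-plane
(i.e. `k`-dimensional linear subspace) `V`. -/
structure IsHomogeneousAt {n : ℕ} {N : Type*} [MeasurableSpace N]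
    (h : EuclideanSpace ℝ (Fin n) → N) (k : ℕ) (y : EuclideanSpace ℝ (Fin n))
    (V : Submodule ℝ (EuclideanSpace ℝ (Fin n))) : Prop where
  measurable : Measurable h
  finrank_eq : Module.finrank ℝ V = k
  dilation : ∀ c : ℝ, 0 < c → ∀ z, h (y + z) = h (y + c • z)
  translation : ∀ z, ∀ v ∈ V, h z = h (z + v)

/-- The rescaled map `T_{x,r} f (z) = f (x + r z)`. -/
def rescaledMap {n : ℕ} {N : Type*} (f : EuclideanSpace ℝ (Fin n) → N)
    (x : EuclideanSpace ℝ (Fin n)) (r : ℝ) (z : EuclideanSpace ℝ (Fin n)) : N :=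
  f (x + r • z)

/-- `V` is a defining `k`-plane for the `(ε, r, k)`-homogeneity at `x` of the map `f`, which is
defined on `U`: the ball `B_r(x)` lies in `U`, and there is a map `h`, `k`-homogeneous at the
origin with respect to the `k`-plane `V`, with `⨍_{B_1(0)} dist(T_{x,r} f, h)² < ε`. -/
def IsDefiningPlane {n : ℕ} {N : Type*} [PseudoEMetricSpace N] [MeasurableSpace N]
    (U : Set (EuclideanSpace ℝ (Fin n))) (f : EuclideanSpace ℝ (Fin n) → N)
    (ε r : ℝ) (k : ℕ) (x : EuclideanSpace ℝ (Fin n))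
    (V : Submodule ℝ (EuclideanSpace ℝ (Fin n))) : Prop :=
  Metric.ball x r ⊆ U ∧
  ∃ h : EuclideanSpace ℝ (Fin n) → N, IsHomogeneousAt h k 0 V ∧
    ⨍⁻ z in Metric.ball (0 : EuclideanSpace ℝ (Fin n)) 1,
      edist (rescaledMap f x r z) (h z) ^ 2 ∂volume < ENNReal.ofReal ε

/-- The map `f`, defined on `U`, is `(ε, r, k)`-homogeneous at `x`. -/
def IsAlmostHomogeneous {n : ℕ} {N : Type*} [PseudoEMetricSpace N] [MeasurableSpace N]
    (U : Set (EuclideanSpace ℝ (Fin n))) (f : EuclideanSpace ℝ (Fin n) → N)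
    (ε r : ℝ) (k : ℕ) (x : EuclideanSpace ℝ (Fin n)) : Prop :=
  ∃ V : Submodule ℝ (EuclideanSpace ℝ (Fin n)), IsDefiningPlane U f ε r k x V

/-- The set `V_{f,x} = B_r(x) ∩ exp_x(V) = B_r(x) ∩ (x + V)`. -/
def planeInBall {n : ℕ} (x : EuclideanSpace ℝ (Fin n)) (r : ℝ)
    (V : Submodule ℝ (EuclideanSpace ℝ (Fin n))) : Set (EuclideanSpace ℝ (Fin n)) :=
  Metric.ball x r ∩ {z | ∃ v ∈ V, z = x + v}

end

/-! The proof is direct and quantitative, without compactness. Let `h` (homogeneous at 0, invariant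
under `V`) and `g` (homogeneous at `y`) be the models of `f`; both are close to `f`, hence to each
other, on `B_2(y)`. A dilation about `y` followed by the inverse dilation about 0 is a translation
along `y`, so `h` is almost invariant under small translations along `y`, and by its own homogeneity
under all bounded ones (`lintegral_edist_translate_le`).

Let `W = V ⊕ ℝy` and let `P` be the projection onto `Wᗮ`. The new model is `h'(z) = h(Pz + |Pz| a
y)`: it is exactly `W`-invariant and homogeneous, and an averaged choice of `a` makes it close to
`h` away from `W` (`exists_slice_le`). Near `W` the distance from `h` to `h'` is controlled by
self-similarity: the tube is covered by few translates of a small copy of the whole cylinder, whose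
contribution is absorbed (`lintegral_sq_cylinder_le`). Every bound is linear in `δ`, so `δ` is a
fixed multiple of `ε`. -/

theorem ENNReal.add_sq_le_two_mul (a b : ℝ≥0∞) : (a + b) ^ 2 ≤ 2 * a ^ 2 + 2 * b ^ 2 := by
  rcases eq_or_ne a ⊤ with rfl | ha
  · simp
  rcases eq_or_ne b ⊤ with rfl | hb
  · simp
  lift a to NNReal using ha
  lift b to NNReal using hb
  have := add_sq_le (a := a) (b := b)
  rw [mul_add] at this
  exact_mod_cast this

/-- The absorption step. Finiteness of `a` is essential, which forces the truncation in
`lintegral_sq_cylinder_le`. -/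
theorem ENNReal.le_two_mul_of_le_add_half {a b : ℝ≥0∞} (ha : a ≠ ⊤) (h : a ≤ b + a / 2) :
    a ≤ 2 * b := by
  have h1 : a / 2 + a / 2 ≤ b + a / 2 := by rwa [ENNReal.add_halves]
  have h2 : a / 2 ≤ b :=
    ENNReal.le_of_add_le_add_right (ENNReal.div_ne_top ha (by norm_num)) h1
  calc a = a / 2 + a / 2 := (ENNReal.add_halves a).symm
    _ ≤ b + b := by gcongr
    _ = 2 * b := (two_mul b).symm

theorem edist_sq_le_two_mul {N : Type*} [PseudoEMetricSpace N] (a b c : N) :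
    edist a c ^ 2 ≤ 2 * edist a b ^ 2 + 2 * edist b c ^ 2 :=
  (pow_le_pow_left₀ (by positivity) (edist_triangle a b c) 2).trans
    (ENNReal.add_sq_le_two_mul _ _)

/-! ### Almost invariance under translations along `y`. -/

section Homothety

variable {E : Type*} [NormedAddCommGroup E] [NormedSpace ℝ E] [FiniteDimensional ℝ E]
  [MeasurableSpace E] [BorelSpace E] (μ : Measure E) [μ.IsAddHaarMeasure]

/-- Change of variables under the homothety `z ↦ p + r • z`. -/
theorem setLIntegral_comp_homothety (F : E → ℝ≥0∞) (S : Set E) (p : E) {r : ℝ} (hr : 0 < r) :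
    ∫⁻ z in (fun z => p + r • z) ⁻¹' S, F (p + r • z) ∂μ
      = (ENNReal.ofReal r ^ Module.finrank ℝ E)⁻¹ * ∫⁻ w in S, F w ∂μ := by
  set φ : E → E := fun z => p + r • z with hφ
  have hemb : MeasurableEmbedding φ :=
    ((Homeomorph.smulOfNeZero r hr.ne').trans (Homeomorph.addLeft p)).measurableEmbedding
  have hmap : μ.map φ = (ENNReal.ofReal r ^ Module.finrank ℝ E)⁻¹ • μ := by
    have h1 : μ.map φ = (μ.map (r • ·)).map (p + ·) := by
      rw [Measure.map_map (by fun_prop) (by fun_prop)]; rfl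
    rw [h1, Measure.map_addHaar_smul μ hr.ne', Measure.map_smul, map_add_left_eq_self]
    congr 1
    rw [abs_of_pos (by positivity), ENNReal.ofReal_inv_of_pos (by positivity),
      ENNReal.ofReal_pow hr.le]
  have h2 := hemb.lintegral_map (μ := μ.restrict (φ ⁻¹' S)) F
  rw [← h2, ← hemb.restrict_map, hmap, Measure.restrict_smul, lintegral_smul_measure, smul_eq_mul]

theorem setLIntegral_preimage_homothety (F : E → ℝ≥0∞) (S : Set E) (p : E) {r : ℝ} (hr : 0 < r) :
    ∫⁻ w in S, F w ∂μ = ENNReal.ofReal r ^ Module.finrank ℝ E *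
      ∫⁻ z in (fun z => p + r • z) ⁻¹' S, F (p + r • z) ∂μ := by
  rw [setLIntegral_comp_homothety μ F S p hr, ← mul_assoc, ENNReal.mul_inv_cancel, one_mul]
  · have : 0 < ENNReal.ofReal r := ENNReal.ofReal_pos.2 hr
    positivity
  · exact ENNReal.pow_ne_top ENNReal.ofReal_ne_top

variable {N : Type*} [PseudoEMetricSpace N] [SecondCountableTopology N] [MeasurableSpace N]
  [BorelSpace N]

/-- If `h` is homogeneous at `0`, `g` is homogeneous at `y` and they are close near `y`, then `h` is
almost invariant under small translations in the direction `y`. -/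
theorem lintegral_edist_small_translate_le {h g : E → N} (mh : Measurable h) (mg : Measurable g)
    {y : E} (hy : ‖y‖ ≤ 1) (hh : ∀ c : ℝ, 0 < c → ∀ z, h (c • z) = h z)
    (hg : ∀ c : ℝ, 0 < c → ∀ z, g (y + c • z) = g (y + z)) {σ : ℝ} (hσ : |σ| ≤ 1 / 4) :
    ∫⁻ w in Metric.closedBall 0 (1 / 4), edist (h w) (h (w + σ • y)) ^ 2 ∂μ
      ≤ (2 + 2 * 2 ^ Module.finrank ℝ E) *
        ∫⁻ w in Metric.ball y 2, edist (h w) (g w) ^ 2 ∂μ := by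
  obtain ⟨hσ1, hσ2⟩ := abs_le.1 hσ
  have hc : 0 < 1 + σ := by linarith
  set c := (1 + σ)⁻¹ with hcdef
  have hcp : 0 < c := inv_pos.2 hc
  have hc2 : c ≤ 4 / 3 := by
    rw [hcdef, inv_le_comm₀ hc (by norm_num)]; linarith
  have hc3 : 1 / 2 ≤ c := by
    rw [hcdef, le_inv_comm₀ (by norm_num) hc]; linarith
  -- `φ` is the dilation about `y` with ratio `c = 1/(1+σ)`, which preserves `g`. It is also the
  -- translation by `σ y` followed by the dilation about 0 with ratio `c`, which preserves `h`.
  set φ : E → E := fun w => (y - c • y) + c • w with hφ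
  have hφ1 : ∀ w, φ w = y + c • (w - y) := fun w => by simp only [hφ, smul_sub]; abel
  have hφ2 : ∀ w, φ w = c • (w + σ • y) := fun w => by
    have : c * (1 + σ) = 1 := inv_mul_cancel₀ hc.ne'
    have h2 : y = (c * (1 + σ)) • y := by rw [this, one_smul]
    simp only [hφ]
    nth_rewrite 1 [h2]
    module
  have key : ∀ w, edist (h w) (h (w + σ • y)) ^ 2
      ≤ 2 * edist (h w) (g w) ^ 2 + 2 * edist (h (φ w)) (g (φ w)) ^ 2 := fun w => by
    have e1 : h (w + σ • y) = h (φ w) := by rw [hφ2, hh c hcp]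
    have e2 : g w = g (φ w) := by rw [hφ1, hg c hcp]; simp
    rw [e1]
    calc _ ≤ _ := edist_sq_le_two_mul _ (g w) _
      _ = _ := by rw [edist_comm (g w), e2]
  have hsub : Metric.closedBall (0 : E) (1 / 4) ⊆ φ ⁻¹' Metric.ball y 2 := fun w hw => by
    have hw' : ‖w‖ ≤ 1 / 4 := by simpa using hw
    have : ‖w - y‖ ≤ 5 / 4 := (norm_sub_le _ _).trans (by linarith)
    simp only [mem_preimage, Metric.mem_ball, dist_eq_norm, hφ1, add_sub_cancel_left, norm_smul,
      Real.norm_eq_abs, abs_of_pos hcp]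
    nlinarith [norm_nonneg (w - y)]
  have hsub1 : Metric.closedBall (0 : E) (1 / 4) ⊆ Metric.ball y 2 := fun w hw => by
    have hw' : ‖w‖ ≤ 1 / 4 := by simpa using hw
    have : ‖w - y‖ ≤ 5 / 4 := (norm_sub_le _ _).trans (by linarith)
    rw [Metric.mem_ball, dist_eq_norm]; linarith
  have hconst : (ENNReal.ofReal c ^ Module.finrank ℝ E)⁻¹ ≤ 2 ^ Module.finrank ℝ E := by
    rw [ENNReal.inv_pow]
    gcongr
    rw [ENNReal.inv_le_iff_inv_le, ← ENNReal.ofReal_ofNat 2, ← ENNReal.ofReal_inv_of_pos (by norm_num)]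
    exact ENNReal.ofReal_le_ofReal (by linarith)
  calc _ ≤ ∫⁻ w in Metric.closedBall 0 (1 / 4),
        (2 * edist (h w) (g w) ^ 2 + 2 * edist (h (φ w)) (g (φ w)) ^ 2) ∂μ :=
        lintegral_mono key
    _ = 2 * ∫⁻ w in Metric.closedBall 0 (1 / 4), edist (h w) (g w) ^ 2 ∂μ
        + 2 * ∫⁻ w in Metric.closedBall 0 (1 / 4), edist (h (φ w)) (g (φ w)) ^ 2 ∂μ := by
      rw [lintegral_add_left (((mh.edist mg).pow_const 2).const_mul 2),
        lintegral_const_mul' _ _ (by norm_num), lintegral_const_mul' _ _ (by norm_num)]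
    _ ≤ 2 * ∫⁻ w in Metric.ball y 2, edist (h w) (g w) ^ 2 ∂μ
        + 2 * ∫⁻ w in φ ⁻¹' Metric.ball y 2, edist (h (φ w)) (g (φ w)) ^ 2 ∂μ := by
      gcongr
    _ = 2 * ∫⁻ w in Metric.ball y 2, edist (h w) (g w) ^ 2 ∂μ
        + 2 * ((ENNReal.ofReal c ^ Module.finrank ℝ E)⁻¹ *
          ∫⁻ w in Metric.ball y 2, edist (h w) (g w) ^ 2 ∂μ) := by
      rw [setLIntegral_comp_homothety μ (fun w => edist (h w) (g w) ^ 2) _ (y - c • y) hcp]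
    _ ≤ 2 * ∫⁻ w in Metric.ball y 2, edist (h w) (g w) ^ 2 ∂μ
        + 2 * (2 ^ Module.finrank ℝ E *
          ∫⁻ w in Metric.ball y 2, edist (h w) (g w) ^ 2 ∂μ) := by gcongr
    _ = _ := by ring

/-- The constant in `lintegral_edist_translate_le`. -/
noncomputable def translateConst (d : ℕ) (R : ℝ) : ℝ≥0∞ :=
  ENNReal.ofReal (4 * (R + 1)) ^ d * (2 + 2 * 2 ^ d)

theorem translateConst_ne_top (d : ℕ) (R : ℝ) : translateConst d R ≠ ⊤ :=
  by unfold translateConst; finiteness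

/-- Dilation by `ρ = 1/(4(R+1))` leaves `h` unchanged and brings both the radius `R` and the shift
`s` below `1/4`, reducing to small translations. The Jacobian is the factor `(4(R+1))^d` of
`translateConst`. -/
theorem lintegral_edist_translate_le {h g : E → N} (mh : Measurable h) (mg : Measurable g)
    {y : E} (hy : ‖y‖ ≤ 1) (hh : ∀ c : ℝ, 0 < c → ∀ z, h (c • z) = h z)
    (hg : ∀ c : ℝ, 0 < c → ∀ z, g (y + c • z) = g (y + z)) {R s : ℝ} (hR : 0 ≤ R) (hs : |s| ≤ R) :
    ∫⁻ w in Metric.closedBall 0 R, edist (h w) (h (w + s • y)) ^ 2 ∂μ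
      ≤ translateConst (Module.finrank ℝ E) R *
        ∫⁻ w in Metric.ball y 2, edist (h w) (g w) ^ 2 ∂μ := by
  set ρ : ℝ := (4 * (R + 1))⁻¹ with hρ
  have hρ0 : 0 < ρ := by positivity
  have hρR : ρ * R ≤ 1 / 4 := by
    rw [hρ, inv_mul_le_iff₀ (by positivity)]; linarith
  have hσ : |ρ * s| ≤ 1 / 4 := by
    rw [abs_mul, abs_of_pos hρ0]
    exact (mul_le_mul_of_nonneg_left hs hρ0.le).trans hρR
  have main := lintegral_edist_small_translate_le μ mh mg hy hh hg hσ
  have hsub : Metric.closedBall (0 : E) R ⊆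
      (fun z => 0 + ρ • z) ⁻¹' Metric.closedBall (0 : E) (1 / 4) := fun w hw => by
    have hw' : ‖w‖ ≤ R := by simpa using hw
    simp only [zero_add, mem_preimage, Metric.mem_closedBall, dist_zero_right, norm_smul,
      Real.norm_eq_abs, abs_of_pos hρ0]
    exact (mul_le_mul_of_nonneg_left hw' hρ0.le).trans hρR
  have hinv : (ENNReal.ofReal ρ ^ Module.finrank ℝ E)⁻¹
      = ENNReal.ofReal (4 * (R + 1)) ^ Module.finrank ℝ E := by
    rw [ENNReal.inv_pow, ← ENNReal.ofReal_inv_of_pos hρ0, hρ, inv_inv]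
  calc _ ≤ ∫⁻ z in (fun z => 0 + ρ • z) ⁻¹' Metric.closedBall (0 : E) (1 / 4),
        edist (h z) (h (z + s • y)) ^ 2 ∂μ := lintegral_mono_set hsub
    _ = ∫⁻ z in (fun z => 0 + ρ • z) ⁻¹' Metric.closedBall (0 : E) (1 / 4),
        edist (h (0 + ρ • z)) (h ((0 + ρ • z) + (ρ * s) • y)) ^ 2 ∂μ := by
      congr 1; ext z
      rw [zero_add, mul_smul, ← smul_add, hh ρ hρ0, hh ρ hρ0]
    _ = (ENNReal.ofReal ρ ^ Module.finrank ℝ E)⁻¹ *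
        ∫⁻ w in Metric.closedBall 0 (1 / 4), edist (h w) (h (w + (ρ * s) • y)) ^ 2 ∂μ :=
      setLIntegral_comp_homothety μ (fun w => edist (h w) (h (w + (ρ * s) • y)) ^ 2) _ 0 hρ0
    _ ≤ _ := by
      rw [hinv, translateConst, mul_assoc]
      gcongr

end Homothety

/-! ### Absorption near the invariant subspace `W`. -/

section Absorption

variable {E : Type*} [NormedAddCommGroup E] [InnerProductSpace ℝ E] [FiniteDimensional ℝ E]

/-- The cylinder around a subspace `W`: the product of a cube in `W` and a ball in `Wᗮ`. -/
def solidCylinder {q : ℕ} {W : Submodule ℝ E} (b : OrthonormalBasis (Fin q) ℝ W) (r : ℝ) : Set E :=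
  {z | (∀ j, |inner ℝ (b j : E) z| ≤ r) ∧ ‖Wᗮ.starProjection z‖ ≤ r}

variable {q : ℕ} {W : Submodule ℝ E} (b : OrthonormalBasis (Fin q) ℝ W)

theorem starProjection_orthogonal_of_mem {p : E} (hp : p ∈ W) : Wᗮ.starProjection p = 0 := by
  rw [Submodule.starProjection_apply_eq_zero_iff]
  exact Submodule.le_orthogonal_orthogonal W hp

theorem sub_starProjection_orthogonal_mem (z : E) : z - Wᗮ.starProjection z ∈ W := by
  have := Wᗮ.sub_starProjection_mem_orthogonal z
  rwa [Submodule.orthogonal_orthogonal] at this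

theorem isClosed_cylinder (r : ℝ) : IsClosed (solidCylinder b r) := by
  have : solidCylinder b r =
      (⋂ j, {z | |inner ℝ (b j : E) z| ≤ r}) ∩ {z | ‖Wᗮ.starProjection z‖ ≤ r} := by
    ext z; simp only [solidCylinder, mem_inter_iff, mem_iInter, mem_ofPred_eq]
  rw [this]
  refine (isClosed_iInter fun j => isClosed_le (by fun_prop) (by fun_prop)).inter
    (isClosed_le (by fun_prop) (by fun_prop))

theorem norm_le_of_mem_cylinder {r : ℝ} {z : E} (hz : z ∈ solidCylinder b r) : ‖z‖ ≤ (q + 1) * r := by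
  have h1 : z = (∑ j, inner ℝ (b j : E) z • (b j : E)) + Wᗮ.starProjection z := by
    have h2 : z - Wᗮ.starProjection z = ((⟨_, sub_starProjection_orthogonal_mem z⟩ : W) : E) := rfl
    rw [← sub_eq_iff_eq_add, h2, ← b.sum_repr' ⟨_, sub_starProjection_orthogonal_mem z⟩]
    push_cast
    refine Finset.sum_congr rfl fun j _ => ?_
    congr 1
    rw [Submodule.coe_inner, inner_sub_right]
    rw [Submodule.inner_right_of_mem_orthogonal (b j).2 (Submodule.starProjection_apply_mem _ _),
      sub_zero]
  calc ‖z‖ ≤ ‖∑ j, inner ℝ (b j : E) z • (b j : E)‖ + ‖Wᗮ.starProjection z‖ := by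
        conv_lhs => rw [h1]
        exact norm_add_le _ _
    _ ≤ (∑ _j : Fin q, r) + r := by
        gcongr
        · refine norm_sum_le_of_le _ fun j _ => ?_
          have : ‖(b j : E)‖ = 1 := b.norm_eq_one j
          rw [norm_smul, this, mul_one]
          exact hz.1 j
        · exact hz.2
    _ = _ := by simp; ring

theorem ball_subset_cylinder (r : ℝ) : Metric.ball (0 : E) r ⊆ solidCylinder b r := fun z hz => by
  have hz' : ‖z‖ ≤ r := by simpa using (Metric.mem_ball.1 hz).le
  refine ⟨fun j => ?_, (Submodule.norm_starProjection_apply_le _ z).trans hz'⟩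
  have : ‖(b j : E)‖ = 1 := b.norm_eq_one j
  calc _ ≤ ‖(b j : E)‖ * ‖z‖ := abs_real_inner_le_norm _ _
    _ ≤ r := by rw [this, one_mul]; exact hz'

theorem smul_preimage_cylinder {c : ℝ} (hc : 0 < c) (r : ℝ) :
    (fun z => (0 : E) + c • z) ⁻¹' solidCylinder b (c * r) = solidCylinder b r := by
  ext z
  simp only [solidCylinder, zero_add, mem_preimage, mem_ofPred_eq, inner_smul_right, map_smul,
    norm_smul, abs_mul, Real.norm_eq_abs, abs_of_pos hc, mul_le_mul_iff_right₀ hc]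

/-- The centres of the cubes of half side `1 / 4` which cover the unit cube of `W`. -/
noncomputable def gridPoint (i : Fin q → Fin 4) : E :=
  ∑ j, ((2 * (i j : ℝ) - 3) / 4) • (b j : E)

theorem gridPoint_mem (i : Fin q → Fin 4) : gridPoint b i ∈ W :=
  W.sum_mem fun j _ => W.smul_mem _ (b j).2

theorem inner_gridPoint (i : Fin q → Fin 4) (j : Fin q) :
    inner ℝ (b j : E) (gridPoint b i) = (2 * (i j : ℝ) - 3) / 4 := by
  have h : ∀ k, inner ℝ (b j : E) (b k : E) = if j = k then (1 : ℝ) else 0 := fun k => by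
    rw [← Submodule.coe_inner]; exact orthonormal_iff_ite.1 b.orthonormal j k
  simp [gridPoint, inner_sum, inner_smul_right, h]

theorem gridPoint_mem_cylinder (i : Fin q → Fin 4) : gridPoint b i ∈ solidCylinder b 1 := by
  refine ⟨fun j => ?_, ?_⟩
  · rw [inner_gridPoint, abs_le]
    have h1 : ((i j : ℕ) : ℝ) ≤ 3 := by exact_mod_cast Nat.le_of_lt_succ (i j).2
    have h2 : (0 : ℝ) ≤ ((i j : ℕ) : ℝ) := by positivity
    constructor <;> linarith
  · rw [starProjection_orthogonal_of_mem (gridPoint_mem b i)]; simp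

theorem exists_fin_four_abs_sub_le {x : ℝ} (hx : |x| ≤ 1) :
    ∃ i : Fin 4, |x - (2 * (i : ℝ) - 3) / 4| ≤ 1 / 4 := by
  obtain ⟨h1, h2⟩ := abs_le.1 hx
  rcases le_total x (-1 / 2) with h | h
  · exact ⟨0, by rw [abs_le]; constructor <;> norm_num <;> linarith⟩
  rcases le_total x 0 with h' | h'
  · exact ⟨1, by rw [abs_le]; constructor <;> norm_num <;> linarith⟩
  rcases le_total x (1 / 2) with h'' | h''
  · exact ⟨2, by rw [abs_le]; constructor <;> norm_num <;> linarith⟩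
  · exact ⟨3, by rw [abs_le]; constructor <;> norm_num <;> linarith⟩

/-- Translations along `W` do not change the `Wᗮ` component, so only the unit cube of `W` has to be
covered: `4^q` cubes of half side `1/4` suffice. -/
theorem tube_subset_iUnion :
    solidCylinder b 1 ∩ {z | ‖Wᗮ.starProjection z‖ ≤ 1 / 4} ⊆
      ⋃ i : Fin q → Fin 4, (fun z => -gridPoint b i + (1 : ℝ) • z) ⁻¹' solidCylinder b (1 / 4) := by
  rintro z ⟨hz, hz'⟩
  choose i hi using fun j => exists_fin_four_abs_sub_le (hz.1 j)
  refine mem_iUnion.2 ⟨i, fun j => ?_, ?_⟩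
  · beta_reduce
    rw [one_smul, neg_add_eq_sub, inner_sub_right, inner_gridPoint]; exact hi j
  · beta_reduce
    rw [one_smul, neg_add_eq_sub, map_sub, starProjection_orthogonal_of_mem (gridPoint_mem b i),
      sub_zero]
    exact hz'

variable [MeasurableSpace E] [BorelSpace E] (μ : Measure E) [μ.IsAddHaarMeasure]

/-- Each of the `4^q` pieces covering the tube is a translate along `W` of the cylinder of size
`1/4`. Up to the error `G`, its integral is that of the small cylinder, which by homogeneity is
`4^{-dim E}` times the full integral. Since `W` is proper, the pieces together contribute at most
half of the full integral. -/
theorem lintegral_sq_cylinder_le_of_bounded (hq : q < Module.finrank ℝ E) {D : E → ℝ≥0∞}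
    (mD : Measurable D) {M : ℝ≥0∞} (hM : M ≠ ⊤) (hDM : ∀ z, D z ≤ M)
    (hD : ∀ c : ℝ, 0 < c → ∀ z, D (c • z) = D z) {G : E → E → ℝ≥0∞}
    {A : ℝ≥0∞} (hDG : ∀ p ∈ W, ∀ z, D (p + z) ≤ D z + G p z)
    (hG : ∀ p ∈ W, p ∈ solidCylinder b 1 → ∫⁻ z in solidCylinder b (1 / 4), G p z ^ 2 ∂μ ≤ A) :
    ∫⁻ z in solidCylinder b 1, D z ^ 2 ∂μ ≤
      2 * (∫⁻ z in solidCylinder b 1 ∩ {z | 1 / 4 < ‖Wᗮ.starProjection z‖}, D z ^ 2 ∂μ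
        + 4 ^ q * (2 * A)) := by
  set J := ∫⁻ z in solidCylinder b 1, D z ^ 2 ∂μ with hJ
  have hJtop : J ≠ ⊤ := by
    have hvol : μ (solidCylinder b 1) < ⊤ := by
      refine (measure_mono fun z hz => ?_).trans_lt
        (measure_closedBall_lt_top (x := (0 : E)) (r := (q + 1) * 1))
      simpa using norm_le_of_mem_cylinder b hz
    refine ((lintegral_mono fun z => pow_le_pow_left₀ (by positivity) (hDM z) 2).trans_lt ?_).ne
    rw [setLIntegral_const]
    exact ENNReal.mul_lt_top (ENNReal.pow_lt_top hM.lt_top) hvol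
  have hscale : ∫⁻ z in solidCylinder b (1 / 4), D z ^ 2 ∂μ
      = ENNReal.ofReal (1 / 4) ^ Module.finrank ℝ E * J := by
    rw [setLIntegral_preimage_homothety μ (fun z => D z ^ 2) _ 0 (r := 1 / 4) (by norm_num)]
    have := smul_preimage_cylinder b (c := 1 / 4) (by norm_num) 1
    rw [mul_one] at this
    rw [this]
    congr 2; ext z
    rw [zero_add, hD _ (by norm_num)]
  have hpiece : ∀ i : Fin q → Fin 4,
      ∫⁻ z in (fun z => -gridPoint b i + (1 : ℝ) • z) ⁻¹' solidCylinder b (1 / 4), D z ^ 2 ∂μ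
        ≤ 2 * (ENNReal.ofReal (1 / 4) ^ Module.finrank ℝ E * J) + 2 * A := fun i => by
    have h1 := setLIntegral_comp_homothety μ (fun w => D (gridPoint b i + w) ^ 2)
      (solidCylinder b (1 / 4)) (-gridPoint b i) one_pos
    simp only [one_smul, add_neg_cancel_left, ENNReal.ofReal_one, one_pow, inv_one, one_mul] at h1
    simp only [one_smul]
    rw [h1, ← hscale]
    calc _ ≤ ∫⁻ w in solidCylinder b (1 / 4), (2 * D w ^ 2 + 2 * G (gridPoint b i) w ^ 2) ∂μ :=
          lintegral_mono fun w => (pow_le_pow_left₀ (by positivity)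
            (hDG _ (gridPoint_mem b i) w) 2).trans (ENNReal.add_sq_le_two_mul _ _)
      _ ≤ _ := by
        rw [lintegral_add_left ((mD.pow_const 2).const_mul 2),
          lintegral_const_mul' _ _ (by norm_num), lintegral_const_mul' _ _ (by norm_num)]
        gcongr
        exact hG _ (gridPoint_mem b i) (gridPoint_mem_cylinder b i)
  -- With `dim E = q + l + 1`, the factor is `2 · 4^q · 4^{-(q+l+1)} = 4^{-l}/2`; the 2 comes from
  -- squaring a sum.
  have hcount : (4 : ℝ≥0∞) ^ q * (2 * (ENNReal.ofReal (1 / 4) ^ Module.finrank ℝ E * J))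
      ≤ J / 2 := by
    obtain ⟨l, hl⟩ := Nat.exists_eq_add_of_lt hq
    have h4 : ENNReal.ofReal (1 / 4) = 4⁻¹ := by
      rw [one_div, ENNReal.ofReal_inv_of_pos (by norm_num), ENNReal.ofReal_ofNat]
    have h5 : (4 : ℝ≥0∞) * 4⁻¹ = 1 := ENNReal.mul_inv_cancel (by norm_num) (by norm_num)
    have h6 : (2 : ℝ≥0∞) * 4⁻¹ = 2⁻¹ := by
      rw [← ENNReal.toReal_eq_toReal_iff' (by finiteness) (by finiteness)]
      norm_num
    calc (4 : ℝ≥0∞) ^ q * (2 * (ENNReal.ofReal (1 / 4) ^ Module.finrank ℝ E * J))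
        = (4 * 4⁻¹) ^ q * (2 * 4⁻¹) * 4⁻¹ ^ l * J := by rw [hl, h4]; ring
      _ ≤ (4 * 4⁻¹) ^ q * (2 * 4⁻¹) * 1 * J := by
          gcongr
          exact pow_le_one₀ (by positivity) (ENNReal.inv_le_one.2 (by norm_num))
      _ = J / 2 := by rw [h5, h6, one_pow, one_mul, mul_one, div_eq_mul_inv, mul_comm]
  refine ENNReal.le_two_mul_of_le_add_half hJtop ?_
  have hsplit : solidCylinder b 1 ⊆ (solidCylinder b 1 ∩ {z | 1 / 4 < ‖Wᗮ.starProjection z‖}) ∪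
      ⋃ i : Fin q → Fin 4, (fun z => -gridPoint b i + (1 : ℝ) • z) ⁻¹' solidCylinder b (1 / 4) :=
    fun z hz => (lt_or_ge (1 / 4) ‖Wᗮ.starProjection z‖).imp (fun h => ⟨hz, h⟩)
      fun h => tube_subset_iUnion b ⟨hz, h⟩
  calc J ≤ _ := lintegral_mono_set hsplit
    _ ≤ _ := lintegral_union_le _ _ _
    _ ≤ ∫⁻ z in solidCylinder b 1 ∩ {z | 1 / 4 < ‖Wᗮ.starProjection z‖}, D z ^ 2 ∂μ +
        ∑ i : Fin q → Fin 4,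
          (2 * (ENNReal.ofReal (1 / 4) ^ Module.finrank ℝ E * J) + 2 * A) := by
      gcongr
      refine (lintegral_iUnion_le _ _).trans ?_
      rw [tsum_fintype]
      exact Finset.sum_le_sum fun i _ => hpiece i
    _ = ∫⁻ z in solidCylinder b 1 ∩ {z | 1 / 4 < ‖Wᗮ.starProjection z‖}, D z ^ 2 ∂μ
        + 4 ^ q * (2 * A)
        + 4 ^ q * (2 * (ENNReal.ofReal (1 / 4) ^ Module.finrank ℝ E * J)) := by
      simp only [Finset.sum_const, Finset.card_univ, Fintype.card_fun, Fintype.card_fin,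
        nsmul_eq_mul, Nat.cast_pow, Nat.cast_ofNat]
      ring
    _ ≤ _ := by gcongr

/-- The truncations `min D M` keep homogeneity and the translation inequality and give bounds
independent of `M`; monotone convergence removes the boundedness assumption. -/
theorem lintegral_sq_cylinder_le (hq : q < Module.finrank ℝ E) {D : E → ℝ≥0∞}
    (mD : Measurable D) (hD : ∀ c : ℝ, 0 < c → ∀ z, D (c • z) = D z) {G : E → E → ℝ≥0∞}
    {A : ℝ≥0∞} (hDG : ∀ p ∈ W, ∀ z, D (p + z) ≤ D z + G p z)
    (hG : ∀ p ∈ W, p ∈ solidCylinder b 1 → ∫⁻ z in solidCylinder b (1 / 4), G p z ^ 2 ∂μ ≤ A) :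
    ∫⁻ z in solidCylinder b 1, D z ^ 2 ∂μ ≤
      2 * (∫⁻ z in solidCylinder b 1 ∩ {z | 1 / 4 < ‖Wᗮ.starProjection z‖}, D z ^ 2 ∂μ
        + 4 ^ q * (2 * A)) := by
  have hsup : ∀ z, D z ^ 2 = ⨆ M : ℕ, min (D z) M ^ 2 := fun z => by
    refine le_antisymm ?_ (iSup_le fun M => pow_le_pow_left₀ (by positivity) (min_le_left _ _) 2)
    have h1 : Filter.Tendsto (fun M : ℕ => min (D z) M ^ 2) Filter.atTop (nhds (D z ^ 2)) := by
      have h2 : Filter.Tendsto (fun M : ℕ => min (D z) (M : ℝ≥0∞)) Filter.atTop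
          (nhds (min (D z) ⊤)) := tendsto_const_nhds.min ENNReal.tendsto_nat_nhds_top
      rw [min_eq_left le_top] at h2
      exact ((ENNReal.continuous_pow 2).tendsto _).comp h2
    exact le_of_tendsto' h1 fun M => le_iSup (fun M : ℕ => min (D z) (M : ℝ≥0∞) ^ 2) M
  simp_rw [hsup]
  rw [lintegral_iSup]
  · refine iSup_le fun M => ?_
    refine (lintegral_sq_cylinder_le_of_bounded b μ hq (D := fun z => min (D z) M)
      (mD.min measurable_const) (ENNReal.natCast_ne_top M) (fun z => min_le_right _ _)
      (fun c hc z => by rw [hD c hc]) (G := G) (fun p hp z => ?_) hG).trans ?_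
    · rcases le_total (D z) M with h | h
      · rw [min_eq_left h]; exact (min_le_left _ _).trans (hDG p hp z)
      · rw [min_eq_right h]; exact (min_le_right _ _).trans le_self_add
    · gcongr with z
      exact le_iSup (fun M : ℕ => min (D z) (M : ℝ≥0∞) ^ 2) M
  · exact fun M => (mD.min measurable_const).pow_const 2
  · intro M M' h z
    have : (M : ℝ≥0∞) ≤ M' := by exact_mod_cast h
    dsimp only
    gcongr

end Absorption

/-! ### Construction of the map invariant under `V ⊕ ℝy`. -/

section Splitting

variable {E : Type*} [NormedAddCommGroup E] [InnerProductSpace ℝ E] [FiniteDimensional ℝ E]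

/-- If `y` is not in `V`, then the projection onto `V ⊕ ℝ y` has a coordinate in direction `y`,
bounded in terms of the distance of `y` from `V`. -/
theorem exists_coordinate (V : Submodule ℝ E) {y : E} {τ : ℝ} (hτ : 0 < τ)
    (hy : τ ≤ ‖y - V.starProjection y‖) :
    ∃ ℓ : E →L[ℝ] ℝ, ℓ y = 1 ∧ (∀ z, |ℓ z| ≤ ‖z‖ / τ) ∧
      ∀ z, ∃ v ∈ V, z = (V ⊔ ℝ ∙ y)ᗮ.starProjection z + v + ℓ z • y := by
  set u := y - V.starProjection y with hu
  have hu0 : 0 < ‖u‖ := hτ.trans_le hy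
  have huV : u ∈ Vᗮ := V.sub_starProjection_mem_orthogonal y
  have huW : u ∈ V ⊔ ℝ ∙ y := by
    refine Submodule.sub_mem _ (Submodule.mem_sup_right (Submodule.mem_span_singleton_self y))
      (Submodule.mem_sup_left (Submodule.starProjection_apply_mem _ _))
  have hVz : ∀ v ∈ V, inner ℝ u v = 0 := fun v hv => Submodule.inner_left_of_mem_orthogonal hv huV
  -- As `u` lies in `Vᗮ ∩ W`, this functional kills both `V` and `Wᗮ`, and the normalisation gives
  -- it the value 1 at `y`.
  set ℓ : E →L[ℝ] ℝ := (‖u‖ ^ 2)⁻¹ • innerSL ℝ u with hℓ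
  have hℓa : ∀ z, ℓ z = (‖u‖ ^ 2)⁻¹ * inner ℝ u z := fun z => rfl
  have hℓy : ℓ y = 1 := by
    have : y = u + V.starProjection y := by rw [hu]; abel
    rw [hℓa, this, inner_add_right, hVz _ (Submodule.starProjection_apply_mem _ _),
      real_inner_self_eq_norm_sq, add_zero, inv_mul_cancel₀ (by positivity)]
  refine ⟨ℓ, hℓy, fun z => ?_, fun z => ?_⟩
  · rw [hℓa, abs_mul, abs_of_pos (by positivity)]
    calc _ ≤ (‖u‖ ^ 2)⁻¹ * (‖u‖ * ‖z‖) := by gcongr; exact abs_real_inner_le_norm _ _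
      _ = ‖z‖ / ‖u‖ := by field_simp
      _ ≤ ‖z‖ / τ := by gcongr
  · obtain ⟨v, hv, w, hw, hvw⟩ := Submodule.mem_sup.1 (sub_starProjection_orthogonal_mem (W := V ⊔ ℝ ∙ y) z)
    obtain ⟨c, rfl⟩ := Submodule.mem_span_singleton.1 hw
    have hz : z = (V ⊔ ℝ ∙ y)ᗮ.starProjection z + v + c • y := by
      rw [add_assoc, hvw]; abel
    have hc : ℓ z = c := by
      have h1 : ℓ ((V ⊔ ℝ ∙ y)ᗮ.starProjection z) = 0 := by
        rw [hℓa, Submodule.inner_right_of_mem_orthogonal huW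
          (Submodule.starProjection_apply_mem _ _), mul_zero]
      have h2 : ℓ v = 0 := by rw [hℓa, hVz v hv, mul_zero]
      rw [hz, map_add, map_add, h1, h2, map_smul, hℓy]; simp
    exact ⟨v, hv, by rw [hc]; exact hz⟩

variable [MeasurableSpace E] [BorelSpace E] (μ : Measure E) [μ.IsAddHaarMeasure]
variable {N : Type*} [PseudoEMetricSpace N] [SecondCountableTopology N] [MeasurableSpace N]
  [BorelSpace N]

/-- A slice, chosen by averaging, on which a map which is almost invariant in the direction `y` is
close to the map itself. -/
theorem exists_slice_le {h : E → N} (mh : Measurable h)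
    (y : E) {r ℓ : E → ℝ}
    (cr : Continuous r) (cℓ : Continuous ℓ) {T : Set E} (mT : MeasurableSet T) {R : ℝ}
    (hr : ∀ z ∈ T, 1 / 4 < r z) (hR : ∀ z ∈ T, r z + |ℓ z| ≤ R) {A : ℝ≥0∞}
    (hA : ∀ s : ℝ, |s| ≤ R → ∫⁻ z in T, edist (h z) (h (z + s • y)) ^ 2 ∂μ ≤ A) :
    ∃ a : ℝ, ∫⁻ z in T, edist (h z) (h (z + (-ℓ z + r z • a) • y)) ^ 2 ∂μ
      ≤ 4 * (A * ENNReal.ofReal (2 * R)) := by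
  have : IsProbabilityMeasure (volume.restrict (Icc (0 : ℝ) 1)) := ⟨by simp⟩
  have m1 : Measurable fun p : E × ℝ =>
      edist (h p.1) (h (p.1 + (-ℓ p.1 + r p.1 • p.2) • y)) ^ 2 :=
    ((mh.comp measurable_fst).edist (mh.comp (by fun_prop))).pow_const 2
  have m2 : Measurable fun p : E × ℝ => edist (h p.1) (h (p.1 + p.2 • y)) ^ 2 :=
    ((mh.comp measurable_fst).edist (mh.comp (by fun_prop))).pow_const 2
  -- Some `a` in `[0,1]` does no worse than the mean.
  obtain ⟨a, ha⟩ := exists_le_lintegral (μ := volume.restrict (Icc (0 : ℝ) 1))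
    (f := fun a => ∫⁻ z in T, edist (h z) (h (z + (-ℓ z + r z • a) • y)) ^ 2 ∂μ)
    m1.lintegral_prod_left'.aemeasurable
  refine ⟨a, ha.trans ?_⟩
  rw [← lintegral_lintegral_swap (f := fun z a =>
    edist (h z) (h (z + (-ℓ z + r z • a) • y)) ^ 2) m1.aemeasurable]
  -- For fixed `z`, substitute `s = -ℓ z + r z · a`: the image stays in `[-R, R]`, and the Jacobian
  -- `1/r z` is below 4. This is why the region near `W` is excluded.
  have hz : ∀ z ∈ T, ∫⁻ a in Icc (0 : ℝ) 1, edist (h z) (h (z + (-ℓ z + r z • a) • y)) ^ 2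
      ≤ 4 * ∫⁻ s in Icc (-R) R, edist (h z) (h (z + s • y)) ^ 2 := fun z hzT => by
    have hr0 : 0 < r z := lt_trans (by norm_num) (hr z hzT)
    have h1 := setLIntegral_comp_homothety (volume : Measure ℝ)
      (fun s => edist (h z) (h (z + s • y)) ^ 2) (Icc (-R) R) (-ℓ z) hr0
    have hsub : Icc (0 : ℝ) 1 ⊆ (fun a => -ℓ z + r z • a) ⁻¹' Icc (-R) R := fun a ha => by
      have := abs_le.1 (le_refl |ℓ z|)
      have h2 := hR z hzT
      have h3 : r z * a ≤ r z := mul_le_of_le_one_right hr0.le ha.2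
      have h4 : 0 ≤ r z * a := mul_nonneg hr0.le ha.1
      rw [mem_preimage, smul_eq_mul]
      constructor <;> linarith
    refine (lintegral_mono_set hsub).trans ?_
    rw [h1]
    gcongr
    rw [Module.finrank_self, pow_one, ENNReal.inv_le_iff_inv_le, ← ENNReal.ofReal_ofNat 4,
      ← ENNReal.ofReal_inv_of_pos (by norm_num)]
    exact ENNReal.ofReal_le_ofReal (by linarith [hr z hzT])
  calc _ ≤ ∫⁻ z in T, 4 * (∫⁻ s in Icc (-R) R, edist (h z) (h (z + s • y)) ^ 2) ∂μ :=
        setLIntegral_mono' mT hz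
    _ = 4 * ∫⁻ s in Icc (-R) R, (∫⁻ z in T, edist (h z) (h (z + s • y)) ^ 2 ∂μ) := by
      rw [lintegral_const_mul' _ _ (by norm_num),
        lintegral_lintegral_swap (f := fun z s => edist (h z) (h (z + s • y)) ^ 2)
          m2.aemeasurable]
    _ ≤ 4 * ∫⁻ _ in Icc (-R) R, A := by
      gcongr 4 * ?_
      exact setLIntegral_mono' measurableSet_Icc fun s hs => hA s (abs_le.2 hs)
    _ = _ := by
      rw [setLIntegral_const, Real.volume_Icc, sub_neg_eq_add, ← two_mul]

/-- The radius up to which translations are considered in `exists_split`. -/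
noncomputable def splitRadius (d : ℕ) (τ : ℝ) : ℝ := (d + 1) * (1 + 1 / τ) + 1

/-- The constant in `exists_split`. -/
noncomputable def splitConst (d : ℕ) (τ : ℝ) : ℝ≥0∞ :=
  2 * (4 * (translateConst d (splitRadius d τ) * ENNReal.ofReal (2 * splitRadius d τ))
    + 4 ^ d * (2 * translateConst d (splitRadius d τ)))

theorem splitConst_ne_top (d : ℕ) (τ : ℝ) : splitConst d τ ≠ ⊤ := by
  have := translateConst_ne_top d (splitRadius d τ)
  unfold splitConst; finiteness

theorem translateConst_le_splitConst (d : ℕ) (τ : ℝ) :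
    translateConst d (splitRadius d τ) ≤ splitConst d τ := by
  unfold splitConst
  set K := translateConst d (splitRadius d τ)
  calc K = 1 * (0 + 1 * (1 * K)) := by ring
    _ ≤ _ := by
      gcongr
      · norm_num
      · positivity
      · exact one_le_pow₀ (by norm_num)
      · norm_num

/-- Quantitative cone splitting for exactly homogeneous maps: if `h` is homogeneous at `0` and
invariant under `V`, and is close near `y` to a map `g` which is homogeneous at `y`, then it is
close to a map which is homogeneous at `0` and invariant under `V ⊕ ℝ y`. -/
theorem exists_split {h g : E → N} (mh : Measurable h) (mg : Measurable g)
    (V : Submodule ℝ E) {y : E} {τ : ℝ} (hτ : 0 < τ) (hyV : τ ≤ ‖y - V.starProjection y‖)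
    (hy : ‖y‖ ≤ 1) (hh : ∀ c : ℝ, 0 < c → ∀ z, h (c • z) = h z)
    (hV : ∀ z, ∀ v ∈ V, h (z + v) = h z)
    (hg : ∀ c : ℝ, 0 < c → ∀ z, g (y + c • z) = g (y + z)) :
    ∃ h' : E → N, Measurable h' ∧ (∀ c : ℝ, 0 < c → ∀ z, h' (c • z) = h' z) ∧
      (∀ z, ∀ w ∈ V ⊔ ℝ ∙ y, h' (z + w) = h' z) ∧
      ∫⁻ z in Metric.ball 0 1, edist (h z) (h' z) ^ 2 ∂μ ≤
        splitConst (Module.finrank ℝ E) τ *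
          ∫⁻ z in Metric.ball y 2, edist (h z) (g z) ^ 2 ∂μ := by
  obtain ⟨ℓ, hℓy, hℓb, hℓ⟩ := exists_coordinate V hτ hyV
  set W := V ⊔ ℝ ∙ y with hW
  set d := Module.finrank ℝ E with hd
  set R := splitRadius d τ with hRdef
  set A := ∫⁻ z in Metric.ball y 2, edist (h z) (g z) ^ 2 ∂μ
  -- The unit cylinder lies in the ball of radius `d + 1`, where `|ℓ| ≤ (d+1)/τ`; the extra 1 in `R`
  -- allows for `|Pz| ≤ 1`.
  have hR1 : (d : ℝ) + 1 ≤ R := by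
    have : 0 ≤ ((d : ℝ) + 1) * (1 / τ) := by positivity
    rw [hRdef, splitRadius]; linarith
  have hR2 : 1 + ((d : ℝ) + 1) / τ ≤ R := by
    have : ((d : ℝ) + 1) * (1 / τ) = ((d : ℝ) + 1) / τ := by ring
    have h0 : (0 : ℝ) ≤ d := by positivity
    rw [hRdef, splitRadius]; linarith
  have hR0 : 0 ≤ R := le_trans (by positivity) hR1
  have hT : ∀ s : ℝ, |s| ≤ R → ∀ S ⊆ Metric.closedBall (0 : E) R,
      ∫⁻ z in S, edist (h z) (h (z + s • y)) ^ 2 ∂μ ≤ translateConst d R * A :=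
    fun s hs S hS => (lintegral_mono_set hS).trans
      (lintegral_edist_translate_le μ mh mg hy hh hg hR0 hs)
  have hℓball : ∀ z : E, ‖z‖ ≤ d + 1 → |ℓ z| + 1 ≤ R := fun z hz => by
    have : |ℓ z| ≤ (d + 1) / τ := (hℓb z).trans (by gcongr)
    linarith
  rcases (Submodule.finrank_le W).lt_or_eq with hq | hq
  · set q := Module.finrank ℝ W with hqdef
    have hqd : (q : ℝ) ≤ d := by exact_mod_cast hq.le
    set b := stdOrthonormalBasis ℝ W with hb
    have hcyl : ∀ z ∈ solidCylinder b 1, ‖z‖ ≤ d + 1 := fun z hz =>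
      (norm_le_of_mem_cylinder b hz).trans (by linarith)
    have hcylR : solidCylinder b 1 ⊆ Metric.closedBall (0 : E) R := fun z hz => by
      have := hcyl z hz
      rw [mem_closedBall_zero_iff]; linarith
    have hcyl4 : solidCylinder b (1 / 4) ⊆ solidCylinder b 1 := fun z hz =>
      ⟨fun j => (hz.1 j).trans (by norm_num), hz.2.trans (by norm_num)⟩
    -- Removing the `y` coordinate of `z` leaves `Pz` plus a vector of `V`, which `h` ignores.
    have hslice : ∀ z (s : ℝ), h (z + (-ℓ z + s) • y) = h (Wᗮ.starProjection z + s • y) :=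
      fun z s => by
        obtain ⟨v, hv, hz⟩ := hℓ z
        have : z + (-ℓ z + s) • y = Wᗮ.starProjection z + s • y + v := by
          nth_rewrite 1 [hz]
          module
        rw [this, hV _ v hv]
    obtain ⟨a, ha⟩ := exists_slice_le μ mh y (r := fun z => ‖Wᗮ.starProjection z‖) (ℓ := ℓ)
      (by fun_prop) ℓ.continuous
      (T := solidCylinder b 1 ∩ {z | 1 / 4 < ‖Wᗮ.starProjection z‖}) (R := R)
      ((isClosed_cylinder b 1).measurableSet.inter
        (measurableSet_lt measurable_const (by fun_prop)))
      (fun z hz => hz.2) (fun z hz => by linarith [hℓball z (hcyl z hz.1), hz.1.2])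
      (fun s hs => hT s hs _ (inter_subset_left.trans hcylR))
    simp only [hslice] at ha
    -- Dependence on `Pz` alone gives `W`-invariance. The shift is proportional to `|Pz|` because a
    -- constant shift would destroy homogeneity.
    set h' : E → N := fun z => h (Wᗮ.starProjection z + (‖Wᗮ.starProjection z‖ • a) • y) with hh'
    have mh' : Measurable h' := mh.comp (by fun_prop)
    have hdil : ∀ c : ℝ, 0 < c → ∀ z, h' (c • z) = h' z := fun c hc z => by
      simp only [hh', map_smul, norm_smul, Real.norm_eq_abs, abs_of_pos hc]
      rw [← hh c hc (Wᗮ.starProjection z + (‖Wᗮ.starProjection z‖ • a) • y)]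
      congr 1
      module
    have htr : ∀ z, ∀ w ∈ W, h' (z + w) = h' z := fun z w hw => by
      simp only [hh', map_add, starProjection_orthogonal_of_mem hw, add_zero]
    refine ⟨h', mh', hdil, htr, ?_⟩
    have main := lintegral_sq_cylinder_le b μ hq (D := fun z => edist (h z) (h' z))
      (mh.edist mh') (fun c hc z => by rw [hh c hc, hdil c hc])
      (G := fun p z => edist (h z) (h (z + ℓ p • y))) (A := translateConst d R * A)
      (fun p hp z => ?_) (fun p hp hpc => ?_)
    · refine (lintegral_mono_set (ball_subset_cylinder b 1)).trans (main.trans ?_)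
      calc _ ≤ 2 * (4 * (translateConst d R * A * ENNReal.ofReal (2 * R))
            + 4 ^ d * (2 * (translateConst d R * A))) := by
            gcongr
            norm_num
        _ = _ := by rw [splitConst]; ring
    · obtain ⟨v, hv, hpv⟩ := hℓ p
      rw [starProjection_orthogonal_of_mem hp, zero_add] at hpv
      have e1 : h (p + z) = h (z + ℓ p • y) := by
        rw [← hV (z + ℓ p • y) v hv]
        congr 1
        nth_rewrite 1 [hpv]
        abel
      have e2 : h' (p + z) = h' z := by rw [add_comm, htr z p hp]
      rw [e1, e2, add_comm (edist _ _), edist_comm (h z) (h (z + ℓ p • y))]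
      exact edist_triangle _ _ _
    · refine hT (ℓ p) ?_ _ (hcyl4.trans hcylR)
      linarith [hℓball p (hcyl p hpc)]
  -- If `W` is the whole space, `h` depends only on `ℓ` and is constant on `ℓ > 0`. Translation by
  -- `R y` carries the unit ball into that half-space, so `h` is close to a constant.
  · have hWtop : W = ⊤ := Submodule.eq_top_of_finrank_eq hq
    have hPz : ∀ z, Wᗮ.starProjection z = 0 := fun z =>
      starProjection_orthogonal_of_mem (by rw [hWtop]; trivial)
    have hz : ∀ z, h z = h (ℓ z • y) := fun z => by
      obtain ⟨v, hv, hzv⟩ := hℓ z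
      rw [hPz, zero_add] at hzv
      conv_lhs => rw [hzv, add_comm, hV _ v hv]
    have hpos : ∀ z, 0 < ℓ z → h z = h y := fun z hz0 => by rw [hz, hh _ hz0]
    refine ⟨fun _ => h y, measurable_const, fun _ _ _ => rfl, fun _ _ _ => rfl, ?_⟩
    calc _ ≤ ∫⁻ z in Metric.ball 0 1, edist (h z) (h (z + R • y)) ^ 2 ∂μ := by
          refine setLIntegral_mono' measurableSet_ball fun z hzb => ?_
          have hz1 : ‖z‖ ≤ d + 1 := by
            have h0 : (0 : ℝ) ≤ d := by positivity
            linarith [mem_ball_zero_iff.1 hzb]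
          have : 0 < ℓ (z + R • y) := by
            rw [map_add, map_smul, hℓy, smul_eq_mul, mul_one]
            linarith [hℓball z hz1, neg_abs_le (ℓ z)]
          rw [hpos _ this]
      _ ≤ translateConst d R * A := by
          refine hT R (abs_of_nonneg hR0).le _ ((Metric.ball_subset_closedBall).trans
            (Metric.closedBall_subset_closedBall ?_))
          have h0 : (0 : ℝ) ≤ d := by positivity
          linarith
      _ ≤ _ := by gcongr; exact translateConst_le_splitConst d τ

end Splitting

/-! ### Passage from almost homogeneous to exactly homogeneous maps. -/

/-- The closeness to a homogeneous map, as an integral over the ball `B_r(x)`. -/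
theorem IsDefiningPlane.exists_lintegral_le {n : ℕ} {N : Type*} [PseudoEMetricSpace N]
    [MeasurableSpace N] {U : Set (EuclideanSpace ℝ (Fin n))} {f : EuclideanSpace ℝ (Fin n) → N}
    {δ r : ℝ} {k : ℕ} {x : EuclideanSpace ℝ (Fin n)} {V : Submodule ℝ (EuclideanSpace ℝ (Fin n))}
    (hf : IsDefiningPlane U f δ r k x V) (hr : 0 < r) :
    ∃ h : EuclideanSpace ℝ (Fin n) → N, IsHomogeneousAt h k 0 V ∧
      ∫⁻ w in Metric.ball x r, edist (f w) (h (w - x)) ^ 2 ≤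
        ENNReal.ofReal r ^ n *
          (volume (Metric.ball (0 : EuclideanSpace ℝ (Fin n)) 1) * ENNReal.ofReal δ) := by
  obtain ⟨-, h, hh, hlt⟩ := hf
  refine ⟨h, hh, ?_⟩
  have hdil : ∀ z, h (r • z) = h z := fun z => by
    have := hh.dilation r hr z
    simpa using this.symm
  have hpre : (fun z => x + r • z) ⁻¹' Metric.ball x r
      = Metric.ball (0 : EuclideanSpace ℝ (Fin n)) 1 := by
    ext z
    simp [dist_eq_norm, norm_smul, abs_of_pos hr, hr]
  rw [setLIntegral_preimage_homothety volume _ (Metric.ball x r) x hr, hpre,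
    finrank_euclideanSpace_fin]
  gcongr
  rw [setLAverage_eq, ENNReal.div_eq_inv_mul] at hlt
  have h1 : volume (Metric.ball (0 : EuclideanSpace ℝ (Fin n)) 1) ≠ 0 :=
    (Metric.measure_ball_pos _ _ one_pos).ne'
  have h2 : volume (Metric.ball (0 : EuclideanSpace ℝ (Fin n)) 1) ≠ ⊤ := measure_ball_lt_top.ne
  simp only [add_sub_cancel_left, hdil]
  rw [← ENNReal.inv_mul_le_iff h1 h2]
  exact hlt.le

theorem lemma5p1 (n m : ℕ) (N : Type*) [EMetricSpace N] [SecondCountableTopology N]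
    [ChartedSpace (EuclideanSpace ℝ (Fin m)) N] [IsManifold (𝓡 m) ∞ N]
    [RiemannianBundle (fun p : N => TangentSpace (𝓡 m) p)]
    [IsContMDiffRiemannianBundle (𝓡 m) ∞ (EuclideanSpace ℝ (Fin m))
      (fun p : N => TangentSpace (𝓡 m) p)]
    [IsRiemannianManifold (𝓡 m) N] [MeasurableSpace N] [BorelSpace N]
    (Λ ε τ γ : ℝ) (hε : 0 < ε) (hτ : 0 < τ) (hγ : 0 < γ) :
    ∃ δ : ℝ, 0 < δ ∧
      ∀ (L : ℕ) (Φ : N → EuclideanSpace ℝ (Fin L)), IsIsometricEmbedding (m := m) Φ →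
      ∀ f : EuclideanSpace ℝ (Fin n) → N,
        IsStationaryHarmonicMap (m := m) Φ (Metric.ball 0 γ⁻¹) f →
        dirichletEnergy (Metric.ball 0 γ⁻¹) (Φ ∘ f) < ENNReal.ofReal Λ →
      ∀ (k : ℕ) (V : Submodule ℝ (EuclideanSpace ℝ (Fin n))),
        IsDefiningPlane (Metric.ball 0 γ⁻¹) f δ γ⁻¹ k 0 V →
        (∃ y ∈ Metric.ball (0 : EuclideanSpace ℝ (Fin n)) 1 \
            Metric.thickening τ (planeInBall 0 γ⁻¹ V),
          IsAlmostHomogeneous (Metric.ball 0 γ⁻¹) f δ 2 0 y) →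
        IsAlmostHomogeneous (Metric.ball 0 γ⁻¹) f ε 1 (k + 1) 0 := by
  -- The first term is the cost of replacing `f` by `h`; the second is `exists_split` applied to the
  -- distance from `h` to `g`, itself bounded through `f`. The powers of `γ⁻¹` and 2 undo the
  -- rescaling to the unit ball.
  set K : ℝ≥0∞ := 2 * ENNReal.ofReal γ⁻¹ ^ n +
    2 * (splitConst n τ * (2 * ENNReal.ofReal γ⁻¹ ^ n + 2 * ENNReal.ofReal 2 ^ n)) with hK
  have hKtop : K ≠ ⊤ := by
    have := splitConst_ne_top n τ
    rw [hK]; finiteness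
  have hδ : 0 < ε / (K.toReal + 1) := by positivity
  have hKδ : K * ENNReal.ofReal (ε / (K.toReal + 1)) < ENNReal.ofReal ε := by
    nth_rewrite 1 [← ENNReal.ofReal_toReal hKtop]
    rw [← ENNReal.ofReal_mul ENNReal.toReal_nonneg, ENNReal.ofReal_lt_ofReal_iff hε,
      ← mul_div_assoc, div_lt_iff₀ (by positivity)]
    nlinarith
  refine ⟨ε / (K.toReal + 1), hδ, ?_⟩
  set δ := ε / (K.toReal + 1)
  intro L Φ _ f hf _ k V hV ⟨y, ⟨hy1, hy2⟩, V₀, hV₀⟩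
  have mf := hf.aemeasurable
  have hball : Metric.ball y 2 ⊆ Metric.ball 0 γ⁻¹ := hV₀.1
  have hyn : ‖y‖ < 1 := mem_ball_zero_iff.1 hy1
  have hball1 : Metric.ball (0 : EuclideanSpace ℝ (Fin n)) 1 ⊆ Metric.ball y 2 :=
    Metric.ball_subset_ball' (by rw [dist_zero_left]; linarith)
  have hyγ : ‖y‖ < γ⁻¹ := mem_ball_zero_iff.1 (hball (Metric.mem_ball_self two_pos))
  -- The truncation of the plane is harmless: the projection of `y` to `V` has norm at most `|y| <
  -- γ⁻¹`, so it belongs to the truncated plane.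
  have hyV : τ ≤ ‖y - V.starProjection y‖ := by
    by_contra! hlt
    refine hy2 (Metric.mem_thickening_iff.2 ⟨V.starProjection y, ⟨?_, _,
      Submodule.starProjection_apply_mem _ _, (zero_add _).symm⟩, by rwa [dist_eq_norm]⟩)
    exact mem_ball_zero_iff.2 ((Submodule.norm_starProjection_apply_le _ _).trans_lt hyγ)
  have hyV' : y ∉ V := fun hyV' => by
    rw [Submodule.starProjection_eq_self_iff.2 hyV', sub_self, norm_zero] at hyV
    linarith
  obtain ⟨h, hh, hhle⟩ := hV.exists_lintegral_le (inv_pos.2 hγ)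
  obtain ⟨g, hg, hgle⟩ := hV₀.exists_lintegral_le two_pos
  simp only [sub_zero] at hhle
  have mh := hh.measurable
  have mg : Measurable fun w => g (w - y) := hg.measurable.comp (by fun_prop)
  obtain ⟨h', mh', hdil, htr, hle⟩ := exists_split volume mh mg V hτ hyV hyn.le
    (fun c hc z => by simpa using (hh.dilation c hc z).symm)
    (fun z v hv => (hh.translation z v hv).symm)
    (fun c hc z => by simpa using (hg.dilation c hc z).symm)
  rw [finrank_euclideanSpace_fin] at hle
  set v := volume (Metric.ball (0 : EuclideanSpace ℝ (Fin n)) 1) with hv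
  have hv0 : v ≠ 0 := (Metric.measure_ball_pos _ _ one_pos).ne'
  have hvtop : v ≠ ⊤ := measure_ball_lt_top.ne
  -- Both models are compared with `f` on `B_2(y)`, which lies in `B_{γ⁻¹}(0)` by the homogeneity
  -- assumption at `y`.
  have hE : ∫⁻ w in Metric.ball y 2, edist (h w) (g (w - y)) ^ 2 ≤
      2 * (ENNReal.ofReal γ⁻¹ ^ n * (v * ENNReal.ofReal δ))
        + 2 * (ENNReal.ofReal 2 ^ n * (v * ENNReal.ofReal δ)) :=
    calc _ ≤ ∫⁻ w in Metric.ball y 2,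
          (2 * edist (f w) (h w) ^ 2 + 2 * edist (f w) (g (w - y)) ^ 2) :=
          lintegral_mono fun w => by
            rw [edist_comm (f w) (h w)]; exact edist_sq_le_two_mul _ _ _
      _ = 2 * (∫⁻ w in Metric.ball y 2, edist (f w) (h w) ^ 2)
          + 2 * ∫⁻ w in Metric.ball y 2, edist (f w) (g (w - y)) ^ 2 := by
        rw [lintegral_add_right' _ (((mf.mono_measure (Measure.restrict_mono hball le_rfl)).edist
          mg.aemeasurable).pow_const 2 |>.const_mul 2),
          lintegral_const_mul' _ _ (by norm_num), lintegral_const_mul' _ _ (by norm_num)]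
      _ ≤ _ := by
        gcongr
        exact (lintegral_mono_set hball).trans hhle
  have hfin : ∫⁻ z in Metric.ball 0 1, edist (f z) (h' z) ^ 2 ≤ v * (K * ENNReal.ofReal δ) :=
    calc _ ≤ ∫⁻ z in Metric.ball 0 1, (2 * edist (f z) (h z) ^ 2 + 2 * edist (h z) (h' z) ^ 2) :=
          lintegral_mono fun z => edist_sq_le_two_mul _ _ _
      _ = 2 * (∫⁻ z in Metric.ball 0 1, edist (f z) (h z) ^ 2)
          + 2 * ∫⁻ z in Metric.ball 0 1, edist (h z) (h' z) ^ 2 := by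
        rw [lintegral_add_right _ (((mh.edist mh').pow_const 2).const_mul 2),
          lintegral_const_mul' _ _ (by norm_num), lintegral_const_mul' _ _ (by norm_num)]
      _ ≤ 2 * (ENNReal.ofReal γ⁻¹ ^ n * (v * ENNReal.ofReal δ))
          + 2 * (splitConst n τ * (2 * (ENNReal.ofReal γ⁻¹ ^ n * (v * ENNReal.ofReal δ))
        + 2 * (ENNReal.ofReal 2 ^ n * (v * ENNReal.ofReal δ)))) := by
        gcongr
        · exact (lintegral_mono_set (hball1.trans hball)).trans hhle
        · exact hle.trans (by gcongr)
      _ = _ := by rw [hK]; ring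
  refine ⟨V ⊔ Submodule.span ℝ {y}, hball1.trans hball, h', ⟨mh', ?_, fun c hc z => ?_,
    fun z w hw => (htr z w hw).symm⟩, ?_⟩
  · rw [Submodule.finrank_sup_span_singleton hyV', hh.finrank_eq]
  · rw [zero_add, zero_add, hdil c hc]
  · simp only [rescaledMap, zero_add, one_smul]
    rw [setLAverage_eq, ENNReal.div_eq_inv_mul]
    refine lt_of_le_of_lt ?_ hKδ
    rwa [ENNReal.inv_mul_le_iff hv0 hvtop]
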